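/- Let $L>0$ and let $c\in L^\infty(0,L)$ be real-valued. Let $\mathcal A u=u''+c\,u$ be the operator on the real Hilbert space $L^2(0,L)$ with domain $D(\mathcal A)=H^2(0,L)\cap H^1_0(0,L)$, and let $(e_j)_{j\ge1}$ be a Hilbert basis of $L^2(0,L)$ consisting of eigenfunctions of $\mathcal A$ (identified with their continuous representatives on $[0,L]$), $\mathcal A e_j=\lambda_j e_j$, with $\lambda_1>\lambda_2>\cdots$ and $\lambda_j\to-\infty$. Let $n\ge0$ be the integer such that $\lambda_j\ge0$ for $1\le j\le n$ and $\lambda_{n+1}<0$. For $j\ge1$ put $$a_j=\frac1L\int_0^L x\,c(x)e_j(x)\,dx,\qquad b_j=-\frac1L\int_0^L x\,e_j(x)\,dx,$$ $$\alpha=\frac1L-\sum_{j\ge n+1}\frac{e_j'(0)}{\lambda_j}a_j,\qquad \beta=-\sum_{j\ge n+1}\frac{e_j'(0)}{\lambda_j}b_j,$$ $$A_1=\begin{pmatrix}0&0&\cdots&0\\ a_1&\lambda_1&&0\\ \vdots&&\ddots&\\ a_n&0&&\lambda_n\end{pmatrix},\quad B_1=\begin{pmatrix}1\\ b_1\\ \vdots\\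 b_n\end{pmatrix},\quad L_1=\begin{pmatrix}\alpha&e_1'(0)&\cdots&e_n'(0)\end{pmatrix},$$ $$A=\begin{pmatrix}A_1&0\\ L_1&0\end{pmatrix}\in\mathbb R^{(n+2)\times(n+2)},\qquad B=\begin{pmatrix}B_1\\ \beta\end{pmatrix}\in\mathbb R^{n+2}.$$ Then the series defining $\alpha$ and $\beta$ converge absolutely, $\det\begin{pmatrix}A_1&B_1\\ L_1&\beta\end{pmatrix}\ne0$ (whether or not $0$ is an eigenvalue of $\mathcal A$), and the pair $(A,B)$ satisfies the Kalman condition $$\operatorname{rank}\begin{pmatrix}B&AB&\cdots&A^{n+1}B\end{pmatrix}=n+2.$$ -/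

import Mathlib

open MeasureTheory Set Filter Topology
open scoped ContDiff

noncomputable section

/-- Lebesgue measure on the interval `(0, L)`. -/
abbrev intervalMeasure (L : ℝ) : Measure ℝ := volume.restrict (Ioo 0 L)

/-- The real Hilbert space `L²(0, L)`. -/
abbrev L2Space (L : ℝ) : Type := Lp ℝ 2 (intervalMeasure L)

/-- Smooth functions with compact support contained in the open interval `(0, L)`. -/
def IsTestFunction (L : ℝ) (φ : ℝ → ℝ) : Prop :=
  ContDiff ℝ ∞ φ ∧ HasCompactSupport φ ∧ tsupport φ ⊆ Ioo 0 L

/-- `u` and `v` are in `L²(0, L)` and `v` is the weak derivative of `u` on `(0, L)`. -/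
def HasWeakDerivL2 (L : ℝ) (u v : ℝ → ℝ) : Prop :=
  MemLp u 2 (intervalMeasure L) ∧ MemLp v 2 (intervalMeasure L) ∧
    ∀ φ : ℝ → ℝ, IsTestFunction L φ →
      ∫ x in Ioo 0 L, u x * deriv φ x = -∫ x in Ioo 0 L, v x * φ x

/-- `u ∈ H²(0, L)`. -/
def MemH2 (L : ℝ) (u : ℝ → ℝ) : Prop :=
  ∃ v w : ℝ → ℝ, HasWeakDerivL2 L u v ∧ HasWeakDerivL2 L v w

/-- `u ∈ H¹₀(0, L)`, the closure of the test functions in the `H¹` norm. -/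
def MemH10 (L : ℝ) (u : ℝ → ℝ) : Prop :=
  ∃ v : ℝ → ℝ, HasWeakDerivL2 L u v ∧
    ∃ φ : ℕ → ℝ → ℝ, (∀ k, IsTestFunction L (φ k)) ∧
      Tendsto (fun k => eLpNorm (fun x => φ k x - u x) 2 (intervalMeasure L)) atTop (𝓝 0) ∧
      Tendsto (fun k => eLpNorm (fun x => deriv (φ k) x - v x) 2 (intervalMeasure L))
        atTop (𝓝 0)

/-- The graph of the operator `𝒜 = ∂ₓₓ + c id` with domain `H²(0, L) ∩ H¹₀(0, L)`:
`u` is in the domain and `𝒜 u = f` in `L²(0, L)`. -/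
def IsOperatorImage (L : ℝ) (c u f : ℝ → ℝ) : Prop :=
  MemH2 L u ∧ MemH10 L u ∧
    ∃ v w : ℝ → ℝ, HasWeakDerivL2 L u v ∧ HasWeakDerivL2 L v w ∧
      f =ᵐ[intervalMeasure L] fun x => w x + c x * u x

/-- `(e j)` is a Hilbert basis of `L²(0, L)` made of eigenfunctions of `𝒜`, each given by its
continuous representative on `[0, L]`, with strictly decreasing eigenvalues `lam j → -∞`.
The indices start at `0`: `e j` and `lam j` are the mode of rank `j + 1`. -/
structure IsEigenbasis (L : ℝ) (c : ℝ → ℝ) (lam : ℕ → ℝ) (e : ℕ → ℝ → ℝ) : Prop where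
  strictAnti : StrictAnti lam
  tendsto_atBot : Tendsto lam atTop atBot
  continuousOn : ∀ j, ContinuousOn (e j) (Icc 0 L)
  eigen : ∀ j, IsOperatorImage L c (e j) (fun x => lam j * e j x)
  hilbertBasis : ∃ b : HilbertBasis ℕ ℝ (L2Space L), ∀ j, b j =ᵐ[intervalMeasure L] e j

/-- The trace `e_j'(0)` (a one-sided derivative at the left end of `[0, L]`). -/
def leftTrace (L : ℝ) (e : ℕ → ℝ → ℝ) (j : ℕ) : ℝ := derivWithin (e j) (Icc 0 L) 0

/-- `a_j = (1/L) ∫₀ᴸ x c(x) e_j(x) dx`. -/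
def coeffA (L : ℝ) (c : ℝ → ℝ) (e : ℕ → ℝ → ℝ) (j : ℕ) : ℝ :=
  1 / L * ∫ x in (0 : ℝ)..L, x * c x * e j x

/-- `b_j = -(1/L) ∫₀ᴸ x e_j(x) dx`. -/
def coeffB (L : ℝ) (e : ℕ → ℝ → ℝ) (j : ℕ) : ℝ :=
  -(1 / L) * ∫ x in (0 : ℝ)..L, x * e j x

/-- The terms, for the modes left out of the truncation, of the series defining `alpha`. -/
def alphaTerm (L : ℝ) (c : ℝ → ℝ) (lam : ℕ → ℝ) (e : ℕ → ℝ → ℝ) (n k : ℕ) : ℝ :=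
  leftTrace L e (n + k) / lam (n + k) * coeffA L c e (n + k)

/-- The terms, for the modes left out of the truncation, of the series defining `beta`. -/
def betaTerm (L : ℝ) (lam : ℕ → ℝ) (e : ℕ → ℝ → ℝ) (n k : ℕ) : ℝ :=
  leftTrace L e (n + k) / lam (n + k) * coeffB L e (n + k)

def alpha (L : ℝ) (c : ℝ → ℝ) (lam : ℕ → ℝ) (e : ℕ → ℝ → ℝ) (n : ℕ) : ℝ :=
  1 / L - ∑' k, alphaTerm L c lam e n k

def beta (L : ℝ) (lam : ℕ → ℝ) (e : ℕ → ℝ → ℝ) (n : ℕ) : ℝ :=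
  -∑' k, betaTerm L lam e n k

/-- The matrix `A₁` of the dynamics of `(u_D, w_1, …, w_n)`. -/
def matA1 (L : ℝ) (c : ℝ → ℝ) (lam : ℕ → ℝ) (e : ℕ → ℝ → ℝ) (n : ℕ) :
    Matrix (Unit ⊕ Fin n) (Unit ⊕ Fin n) ℝ :=
  Matrix.fromBlocks 0 0 (Matrix.of fun i _ => coeffA L c e i)
    (Matrix.diagonal fun i : Fin n => lam i)

/-- `B₁ = (1, b_1, …, b_n)ᵀ`. -/
def matB1 (L : ℝ) (e : ℕ → ℝ → ℝ) (n : ℕ) : Matrix (Unit ⊕ Fin n) Unit ℝ :=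
  Matrix.of fun i _ => Sum.elim (fun _ => 1) (fun j : Fin n => coeffB L e j) i

/-- `L₁ = (α, e_1'(0), …, e_n'(0))`. -/
def matL1 (L : ℝ) (c : ℝ → ℝ) (lam : ℕ → ℝ) (e : ℕ → ℝ → ℝ) (n : ℕ) :
    Matrix Unit (Unit ⊕ Fin n) ℝ :=
  Matrix.of fun _ i => Sum.elim (fun _ => alpha L c lam e n) (fun j : Fin n => leftTrace L e j) i

/-- The `1 × 1` matrix `β`. -/
def matBeta (L : ℝ) (lam : ℕ → ℝ) (e : ℕ → ℝ → ℝ) (n : ℕ) : Matrix Unit Unit ℝ :=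
  Matrix.of fun _ _ => beta L lam e n

/-- `A`, the state matrix for the state `(u_D, w_1, …, w_n, ζ)`. -/
def matA (L : ℝ) (c : ℝ → ℝ) (lam : ℕ → ℝ) (e : ℕ → ℝ → ℝ) (n : ℕ) :
    Matrix ((Unit ⊕ Fin n) ⊕ Unit) ((Unit ⊕ Fin n) ⊕ Unit) ℝ :=
  Matrix.fromBlocks (matA1 L c lam e n) 0 (matL1 L c lam e n) 0

/-- `B`, the control matrix for the state `(u_D, w_1, …, w_n, ζ)`. -/
def matB (L : ℝ) (lam : ℕ → ℝ) (e : ℕ → ℝ → ℝ) (n : ℕ) :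
    Matrix ((Unit ⊕ Fin n) ⊕ Unit) Unit ℝ :=
  Matrix.fromRows (matB1 L e n) (matBeta L lam e n)

/-- The Kalman matrix `(N, M N, …, M^(q-1) N)` of a pair `(M, N)`, `M` being `q × q`. -/
def kalmanMatrix {ι κ : Type*} [Fintype ι] [DecidableEq ι] (M : Matrix ι ι ℝ)
    (N : Matrix ι κ ℝ) : Matrix ι (Fin (Fintype.card ι) × κ) ℝ :=
  Matrix.of fun i p => (M ^ (p.1 : ℕ) * N) i p.2

/-- The Kalman rank condition `rank (N, M N, …, M^(q-1) N) = q`. -/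
def KalmanCondition {ι κ : Type*} [Fintype ι] [DecidableEq ι] [Fintype κ]
    (M : Matrix ι ι ℝ) (N : Matrix ι κ ℝ) : Prop :=
  (kalmanMatrix M N).rank = Fintype.card ι

end

/-!
The eigenfunctions are classical solutions of `e_j'' + c e_j = λ_j e_j` vanishing at both ends:
membership in `H¹₀` makes `e_j` the primitive from `0` of its weak derivative, and the
du Bois-Reymond lemma makes this derivative a primitive of `(λ_j - c) e_j`. Green's formula then
gives, for every `φ` of class `C²`,
`⟨φ'' + c φ, e_j⟩ = e_j'(0) φ(0) - e_j'(L) φ(L) + λ_j ⟨φ, e_j⟩`  (`IsEigenbasis.exists_green`).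

* With `φ = 1 - x / L`, the sequence `e_j'(0) / λ_j` is square summable over the negative
  eigenvalues, as are `a_j` and `b_j` by Bessel's inequality; so both series converge absolutely.
* With `φ = x / L`, one finds `a_j + λ_j b_j = -e_j'(L)`, which is nonzero because the Cauchy problem
  at `L` has a unique solution (`coeffA_add_mul_coeffB_ne_zero`).

A vector `(x₀, (x_j)_{j < n}, y)` in the kernel of the block matrix has `y = 0`. Completing it by
`w_j = -a_j x₀ / λ_j` for the modes left out, and by `w_j = x_j` for the others, one gets
`u = ∑ w_j e_j + x₀ x / L`, which formally solves `u'' + c u = 0` with `u(0) = 0`, `u(L) = x₀`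
and, by the last row, `u'(0) = 0`; hence `u = 0` and the vector is zero. To avoid discussing the
regularity of the series, this is carried out by transposition: summing Green's formula over `j`
gives `⟨u, φ'' + c φ⟩ = x₀ φ'(L)` for all `φ` with `φ(L) = 0`
(`IsEigenbasis.eq_zero_of_mem_kernel`), and an `L²` function with this property for all `φ` that
also satisfy `φ'(L) = 0` is zero by Grönwall's inequality
(`ae_eq_zero_of_forall_integral_eq_zero`).

The Kalman condition follows from the Hautus test. The characteristic polynomial of `A` splits over
`ℝ`, so only real left eigenvectors of `A` orthogonal to `B` have to be excluded. For the eigenvalue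
`0` such a vector is in the left kernel of the invertible block matrix; for a nonzero eigenvalue it
is supported on a single mode `j` and `u_D`, where it would force `a_j + λ_j b_j = 0`.
-/

/-! ### The Hautus test -/

/-- By the Cayley–Hamilton theorem, a row vector orthogonal to the columns of the Kalman matrix is
orthogonal to `M ^ k * N` for all `k`. -/
theorem Matrix.vecMul_pow_mul_eq_zero {ι κ : Type*} [Fintype ι] [DecidableEq ι]
    {M : Matrix ι ι ℝ} {N : Matrix ι κ ℝ} {z : ι → ℝ}
    (h : ∀ k < Fintype.card ι, Matrix.vecMul z (M ^ k * N) = 0) (k : ℕ) :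
    Matrix.vecMul z (M ^ k * N) = 0 := by
  rcases isEmpty_or_nonempty ι with hι | hι
  · ext x
    simp [Matrix.vecMul, dotProduct]
  have hdeg : (Polynomial.X ^ k %ₘ M.charpoly).natDegree < Fintype.card ι := by
    have h1 : M.charpoly ≠ 1 := fun h1 => by
      have := M.charpoly_natDegree_eq_dim
      rw [h1, Polynomial.natDegree_one] at this
      exact Fintype.card_ne_zero this.symm
    have := Polynomial.natDegree_modByMonic_lt (Polynomial.X ^ k) M.charpoly_monic h1
    rwa [Matrix.charpoly_natDegree_eq_dim] at this
  rw [Matrix.pow_eq_aeval_mod_charpoly, Polynomial.aeval_eq_sum_range' hdeg, Matrix.sum_mul]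
  have hsum (s : Finset ℕ) (hs : ∀ i ∈ s, i < Fintype.card ι) : Matrix.vecMul z
      (∑ i ∈ s, ((Polynomial.X ^ k %ₘ M.charpoly).coeff i • M ^ i) * N) = 0 := by
    induction s using Finset.induction_on with
    | empty => simp
    | insert a s ha ih =>
      rw [Finset.sum_insert ha, Matrix.vecMul_add, Matrix.smul_mul, Matrix.vecMul_smul,
        h a (hs a (Finset.mem_insert_self a s)), smul_zero, zero_add,
        ih fun i hi => hs i (Finset.mem_insert_of_mem hi)]
  exact hsum _ fun i hi => Finset.mem_range.1 hi

/-- The **Hautus test** for a matrix whose characteristic polynomial splits over `ℝ`: the row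
vectors orthogonal to the Kalman matrix form an invariant subspace, which contains a left
eigenvector of `M` unless it is zero. -/
theorem kalmanCondition_of_hautus {ι κ : Type*} [Fintype ι] [DecidableEq ι] [Fintype κ]
    {M : Matrix ι ι ℝ} {N : Matrix ι κ ℝ} (hM : M.charpoly.Splits)
    (h : ∀ (μ : ℝ) (z : ι → ℝ), Matrix.vecMul z M = μ • z → Matrix.vecMul z N = 0 → z = 0) :
    KalmanCondition M N := by
  let W : Submodule ℝ (ι → ℝ) :=
    { carrier := {z | ∀ k : ℕ, Matrix.vecMul z (M ^ k * N) = 0}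
      add_mem' := fun {a b} ha hb k => by rw [Matrix.add_vecMul, ha k, hb k, add_zero]
      zero_mem' := fun k => Matrix.zero_vecMul _
      smul_mem' := fun r a ha k => by rw [Matrix.smul_vecMul, ha k, smul_zero] }
  have hinv : ∀ z ∈ W, Matrix.toLin' M.transpose z ∈ W := by
    intro z hz k
    rw [Matrix.toLin'_apply, Matrix.mulVec_transpose, Matrix.vecMul_vecMul, ← Matrix.mul_assoc,
      ← pow_succ']
    exact hz (k + 1)
  have hW : W = ⊥ := by
    by_contra hne
    have : Nontrivial W := Submodule.nontrivial_iff_ne_bot.2 hne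
    let f : Module.End ℝ W := (Matrix.toLin' M.transpose).restrict hinv
    have hf : Polynomial.aeval f M.charpoly = 0 := by
      have h0 : Polynomial.aeval (Matrix.toLin' M.transpose) M.charpoly = 0 := by
        have := (Matrix.toLin' M.transpose).aeval_self_charpoly
        rwa [Matrix.charpoly_toLin', Matrix.charpoly_transpose] at this
      ext1 x
      apply Subtype.ext
      have := LinearMap.congr_fun h0 (x : ι → ℝ)
      have key : ∀ (p : Polynomial ℝ) (x : W), ((Polynomial.aeval f p x : W) : ι → ℝ) =
          Polynomial.aeval (Matrix.toLin' M.transpose) p (x : ι → ℝ) := by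
        intro p x
        induction p using Polynomial.induction_on' generalizing x with
        | add p q hp hq => simp [hp, hq]
        | monomial m r =>
          rw [Polynomial.aeval_monomial, Polynomial.aeval_monomial]
          simp only [Module.algebraMap_end_eq_smul_id, Submodule.coe_smul,
            LinearMap.smul_apply, Module.End.mul_apply, LinearMap.id_apply]
          rw [Module.End.pow_restrict]
          rfl
      rw [key]
      exact this
    have hsp : (minpoly ℝ f).Splits :=
      hM.of_dvd M.charpoly_monic.ne_zero (minpoly.dvd ℝ f hf)
    obtain ⟨μ, hμ⟩ := hsp.exists_eval_eq_zero
      (minpoly.degree_pos (Algebra.IsIntegral.isIntegral f)).ne'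
    obtain ⟨z, hz⟩ := (Module.End.hasEigenvalue_of_isRoot hμ).exists_hasEigenvector
    apply hz.2
    apply Subtype.ext
    refine h μ z ?_ ?_
    · have := congrArg Subtype.val hz.apply_eq_smul
      rw [← Matrix.mulVec_transpose]
      exact this
    · simpa using z.2 0
  refine LinearIndependent.rank_matrix ?_
  rw [← Matrix.vecMul_injective_iff, ← Matrix.coe_vecMulLinear, ← LinearMap.ker_eq_bot,
    LinearMap.ker_eq_bot']
  intro z hz
  have hzW : z ∈ W := by
    refine Matrix.vecMul_pow_mul_eq_zero fun k hk => ?_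
    ext x
    exact congrFun hz (⟨k, hk⟩, x)
  rw [hW] at hzW
  exact hzW

/-! ### The matrices of the truncated system -/

section Matrices

variable {L : ℝ} {c : ℝ → ℝ} {lam : ℕ → ℝ} {e : ℕ → ℝ → ℝ} {n : ℕ}

theorem charpoly_matA_splits : (matA L c lam e n).charpoly.Splits := by
  rw [matA, matA1, Matrix.charpoly_fromBlocks_zero₁₂, Matrix.charpoly_fromBlocks_zero₁₂,
    Matrix.charpoly_diagonal, Matrix.charpoly_zero]
  refine ((Polynomial.Splits.X_pow _).mul ?_).mul (Polynomial.Splits.X_pow _)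
  exact Polynomial.Splits.prod fun i _ => Polynomial.Splits.X_sub_C _

/-- A left eigenvector of `A` orthogonal to `B` vanishes: for the eigenvalue `0` it lies in the
left kernel of the invertible block matrix, and for a nonzero eigenvalue it is supported on a
single mode, which is seen by the control. -/
theorem kalmanCondition_of_det_ne_zero (hlam : StrictAnti lam)
    (hdet : (Matrix.fromBlocks (matA1 L c lam e n) (matB1 L e n)
        (matL1 L c lam e n) (matBeta L lam e n)).det ≠ 0)
    (hab : ∀ j, coeffA L c e j + lam j * coeffB L e j ≠ 0) :
    KalmanCondition (matA L c lam e n) (matB L lam e n) := by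
  refine kalmanCondition_of_hautus charpoly_matA_splits fun μ z hzA hzB => ?_
  obtain rfl | hμ := eq_or_ne μ 0
  · by_contra hz
    refine hdet (Matrix.exists_vecMul_eq_zero_iff.1 ⟨z, hz, ?_⟩)
    ext (i | i)
    · have := congrFun hzA (Sum.inl i)
      simpa [Matrix.vecMul, dotProduct, matA, matB, Fintype.sum_sum_type] using this
    · have := congrFun hzB ()
      simpa [Matrix.vecMul, dotProduct, matA, matB, Fintype.sum_sum_type] using this
  · have hr : z (Sum.inr ()) = 0 := by
      have := congrFun hzA (Sum.inr ())
      simpa [Matrix.vecMul, dotProduct, matA, hμ] using this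
    have hq : ∀ j : Fin n, z (Sum.inl (Sum.inr j)) * lam j = μ * z (Sum.inl (Sum.inr j)) := by
      intro j
      have := congrFun hzA (Sum.inl (Sum.inr j))
      simpa [Matrix.vecMul, dotProduct, matA, matA1, Fintype.sum_sum_type, hr,
        Matrix.diagonal_apply] using this
    have hp : ∑ j : Fin n, z (Sum.inl (Sum.inr j)) * coeffA L c e j
        = μ * z (Sum.inl (Sum.inl ())) := by
      have := congrFun hzA (Sum.inl (Sum.inl ()))
      simpa [Matrix.vecMul, dotProduct, matA, matA1, Fintype.sum_sum_type, hr] using this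
    have hB : z (Sum.inl (Sum.inl ())) + ∑ j : Fin n, z (Sum.inl (Sum.inr j)) * coeffB L e j
        = 0 := by
      have := congrFun hzB ()
      simpa [Matrix.vecMul, dotProduct, matB, matB1, Fintype.sum_sum_type, hr] using this
    have hsum : ∑ j : Fin n, z (Sum.inl (Sum.inr j)) *
        (coeffA L c e j + lam j * coeffB L e j) = 0 := by
      calc _ = ∑ j : Fin n, (z (Sum.inl (Sum.inr j)) * coeffA L c e j
              + μ * (z (Sum.inl (Sum.inr j)) * coeffB L e j)) := by
            refine Finset.sum_congr rfl fun j _ => ?_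
            linear_combination coeffB L e j * hq j
        _ = 0 := by
            rw [Finset.sum_add_distrib, ← Finset.mul_sum, hp]
            linear_combination μ * hB
    have hq0 : ∀ j : Fin n, z (Sum.inl (Sum.inr j)) = 0 := by
      intro j
      by_contra hj
      rw [Finset.sum_eq_single j] at hsum
      · exact (mul_ne_zero hj (hab j)) hsum
      · intro i _ hij
        by_cases hi : z (Sum.inl (Sum.inr i)) = 0
        · rw [hi, zero_mul]
        · refine absurd (Fin.ext (hlam.injective ?_)) hij
          have h1 := mul_left_cancel₀ hi ((hq i).trans (mul_comm _ _))
          have h2 := mul_left_cancel₀ hj ((hq j).trans (mul_comm _ _))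
          rw [h1, h2]
      · simp
    ext ((i | i) | i)
    · simpa [hq0] using hB
    · exact hq0 i
    · exact hr

end Matrices

/-! ### Primitives, integration by parts and uniqueness for the Cauchy problem -/

theorem MeasureTheory.LocallyIntegrable.intervalIntegrable {w : ℝ → ℝ} (hw : LocallyIntegrable w)
    (a b : ℝ) : IntervalIntegrable w volume a b :=
  intervalIntegrable_iff.2 ((hw.integrableOn_isCompact isCompact_uIcc).mono_set uIoc_subset_uIcc)

/-- The absolutely continuous function with value `v₀` at `0` and derivative `w`. -/
noncomputable def primitiveFrom (v₀ : ℝ) (w : ℝ → ℝ) (x : ℝ) : ℝ := v₀ + ∫ t in (0 : ℝ)..x, w t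

theorem primitiveFrom_zero (v₀ : ℝ) (w : ℝ → ℝ) : primitiveFrom v₀ w 0 = v₀ := by
  simp [primitiveFrom]

theorem continuous_primitiveFrom {w : ℝ → ℝ} (hw : LocallyIntegrable w) (v₀ : ℝ) :
    Continuous (primitiveFrom v₀ w) :=
  continuous_const.add (intervalIntegral.continuous_primitive
    (hw.intervalIntegrable) 0)

theorem hasDerivAt_primitiveFrom {w : ℝ → ℝ} (hw : Continuous w) (v₀ x : ℝ) :
    HasDerivAt (primitiveFrom v₀ w) (w x) x :=
  (intervalIntegral.integral_hasDerivAt_right (hw.intervalIntegrable _ _)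
    hw.stronglyMeasurable.stronglyMeasurableAtFilter hw.continuousAt).const_add v₀

theorem integral_primitiveFrom_mul_deriv {w φ φ' : ℝ → ℝ} (hw : LocallyIntegrable w)
    (hφ : ∀ x, HasDerivAt φ (φ' x) x) (hφ' : Continuous φ') (v₀ L : ℝ) :
    ∫ x in (0 : ℝ)..L, primitiveFrom v₀ w x * φ' x =
      primitiveFrom v₀ w L * φ L - v₀ * φ 0 - ∫ x in (0 : ℝ)..L, w x * φ x := by
  have hd : deriv φ = φ' := funext fun x => (hφ x).deriv
  have hφC : ContDiff ℝ 1 φ := contDiff_one_iff_deriv.2 ⟨fun x => (hφ x).differentiableAt, hd ▸ hφ'⟩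
  have hac : AbsolutelyContinuousOnInterval (primitiveFrom v₀ w) 0 L := by
    have h1 : AbsolutelyContinuousOnInterval (fun _ : ℝ => v₀) 0 L :=
      (contDiff_const (n := 1)).contDiffOn.absolutelyContinuousOnInterval
    exact h1.add ((hw.intervalIntegrable _ _).absolutelyContinuousOnInterval_intervalIntegral
      (by simp))
  have hwd : ∀ᵐ x, deriv (primitiveFrom v₀ w) x = w x := by
    filter_upwards [_root_.LocallyIntegrable.ae_hasDerivAt_integral hw] with x hx
    exact ((hx 0).const_add v₀).deriv
  have := hac.integral_mul_deriv_eq_deriv_mul hφC.contDiffOn.absolutelyContinuousOnInterval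
  rw [hd, primitiveFrom_zero] at this
  rw [this]
  congr 1
  refine intervalIntegral.integral_congr_ae ?_
  filter_upwards [hwd] with x hx _
  rw [hx]

/-- Green's formula for the function `y` with `y 0 = 0`, `y' 0 = v₀` and `y'' = w`. -/
theorem integral_primitiveFrom_primitiveFrom_mul {w φ φ' φ'' : ℝ → ℝ} (hw : LocallyIntegrable w)
    (hφ : ∀ x, HasDerivAt φ (φ' x) x) (hφ' : ∀ x, HasDerivAt φ' (φ'' x) x)
    (hφ'' : Continuous φ'') (v₀ L : ℝ) :
    ∫ x in (0 : ℝ)..L, primitiveFrom 0 (primitiveFrom v₀ w) x * φ'' x =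
      primitiveFrom 0 (primitiveFrom v₀ w) L * φ' L - primitiveFrom v₀ w L * φ L + v₀ * φ 0
        + ∫ x in (0 : ℝ)..L, w x * φ x := by
  have hc : Continuous φ' := continuous_iff_continuousAt.2 fun x => (hφ' x).continuousAt
  rw [integral_primitiveFrom_mul_deriv (continuous_primitiveFrom hw v₀).locallyIntegrable hφ' hφ'',
    integral_primitiveFrom_mul_deriv hw hφ hc]
  ring

/-- A form of Grönwall's inequality. -/
theorem eq_zero_of_abs_le_mul_integral {y : ℝ → ℝ} {K L : ℝ} (hy : Continuous y)
    (h : ∀ x ∈ Icc 0 L, |y x| ≤ K * ∫ t in (0 : ℝ)..x, |y t|) : ∀ x ∈ Icc 0 L, y x = 0 := by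
  have hF : ∀ x, HasDerivAt (fun x => ∫ t in (0 : ℝ)..x, |y t|) |y x| x := fun x =>
    intervalIntegral.integral_hasDerivAt_right (hy.abs.intervalIntegrable _ _)
      hy.abs.stronglyMeasurable.stronglyMeasurableAtFilter hy.abs.continuousAt
  have h0 := eq_zero_of_abs_deriv_le_mul_abs_self_of_eq_zero_right (a := 0) (b := L) (K := K)
    (fun x _ => (hF x).continuousAt.continuousWithinAt)
    (fun x _ => (hF x).hasDerivWithinAt) (by simp) (fun x hx => by
      have hpos : 0 ≤ ∫ t in (0 : ℝ)..x, |y t| :=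
        intervalIntegral.integral_nonneg hx.1 fun t _ => abs_nonneg _
      rw [Real.norm_eq_abs, abs_abs, Real.norm_eq_abs, abs_of_nonneg hpos]
      exact h x ⟨hx.1, hx.2.le⟩)
  intro x hx
  have := h x hx
  rw [h0 x hx, mul_zero] at this
  exact abs_nonpos_iff.1 this

/-- The Cauchy problem `y'' = w`, `y 0 = y' 0 = 0` has only the zero solution when `|w| ≤ M |y|`. -/
theorem primitiveFrom_primitiveFrom_eq_zero {w : ℝ → ℝ} {L M : ℝ} (hw : LocallyIntegrable w)
    (hM : 0 ≤ M)
    (h : ∀ᵐ x, x ∈ Ioo 0 L → |w x| ≤ M * |primitiveFrom 0 (primitiveFrom 0 w) x|) :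
    ∀ x ∈ Icc 0 L, primitiveFrom 0 (primitiveFrom 0 w) x = 0 := by
  set v := primitiveFrom 0 w with hv
  set y := primitiveFrom 0 v with hy
  have hvc : Continuous v := continuous_primitiveFrom hw 0
  have hyc : Continuous y := continuous_primitiveFrom hvc.locallyIntegrable 0
  have hmono : ∀ s x, 0 ≤ s → s ≤ x → ∫ t in (0 : ℝ)..s, |y t| ≤ ∫ t in (0 : ℝ)..x, |y t| := by
    intro s x hs hsx
    exact intervalIntegral.integral_mono_interval le_rfl hs hsx
      (Eventually.of_forall fun t => abs_nonneg _) (hyc.abs.intervalIntegrable _ _)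
  have hvb : ∀ x ∈ Icc 0 L, |v x| ≤ M * ∫ t in (0 : ℝ)..x, |y t| := by
    intro x hx
    have h1 : v x = ∫ t in (0 : ℝ)..x, w t := by simp [hv, primitiveFrom]
    rw [h1, ← intervalIntegral.integral_const_mul]
    refine (intervalIntegral.abs_integral_le_integral_abs hx.1).trans ?_
    refine intervalIntegral.integral_mono_ae_restrict hx.1 (hw.intervalIntegrable _ _).abs
      ((hyc.abs.const_mul M).intervalIntegrable _ _) ?_
    rw [← restrict_Ioo_eq_restrict_Icc]
    refine (ae_restrict_iff' measurableSet_Ioo).2 ?_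
    filter_upwards [h] with t ht htx
    exact ht ⟨htx.1, htx.2.trans_le hx.2⟩
  refine eq_zero_of_abs_le_mul_integral (K := L * M) hyc fun x hx => ?_
  have h1 : y x = ∫ t in (0 : ℝ)..x, v t := by simp [hy, primitiveFrom]
  have hI : 0 ≤ ∫ t in (0 : ℝ)..x, |y t| :=
    intervalIntegral.integral_nonneg hx.1 fun t _ => abs_nonneg _
  calc |y x| ≤ ∫ t in (0 : ℝ)..x, |v t| := by
        rw [h1]; exact intervalIntegral.abs_integral_le_integral_abs hx.1
    _ ≤ ∫ t in (0 : ℝ)..x, M * ∫ t in (0 : ℝ)..x, |y t| := by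
        refine intervalIntegral.integral_mono_on hx.1 (hvc.abs.intervalIntegrable _ _)
          (by simp) fun s hs => ?_
        exact (hvb s ⟨hs.1, hs.2.trans hx.2⟩).trans
          (mul_le_mul_of_nonneg_left (hmono s x hs.1 hs.2) hM)
    _ = x * (M * ∫ t in (0 : ℝ)..x, |y t|) := by simp; ring
    _ ≤ L * (M * ∫ t in (0 : ℝ)..x, |y t|) :=
        mul_le_mul_of_nonneg_right hx.2 (mul_nonneg hM hI)
    _ = L * M * ∫ t in (0 : ℝ)..x, |y t| := by ring

/-- The uniqueness statement `primitiveFrom_primitiveFrom_eq_zero` with data at the right end,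
obtained from it by the reflection `x ↦ L - x`. -/
theorem primitiveFrom_primitiveFrom_eq_zero_of_right {w : ℝ → ℝ} {v₀ L M : ℝ}
    (hw : LocallyIntegrable w) (hM : 0 ≤ M)
    (h : ∀ᵐ x, x ∈ Ioo 0 L → |w x| ≤ M * |primitiveFrom 0 (primitiveFrom v₀ w) x|)
    (hy : primitiveFrom 0 (primitiveFrom v₀ w) L = 0) (hv : primitiveFrom v₀ w L = 0) :
    ∀ x ∈ Icc 0 L, primitiveFrom 0 (primitiveFrom v₀ w) x = 0 := by
  have hw' : LocallyIntegrable fun t => w (L - t) := by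
    rw [locallyIntegrable_iff] at hw ⊢
    intro k hk
    have := hw (k := (fun t => L - t) '' k) (hk.image (by fun_prop))
    exact ((Measure.measurePreserving_sub_left volume L).integrableOn_image
      (Homeomorph.subLeft L).measurableEmbedding).1 this
  have hslope : ∀ s, primitiveFrom 0 (fun t => w (L - t)) s = -primitiveFrom v₀ w (L - s) := by
    intro s
    have h1 := intervalIntegral.integral_interval_sub_left (μ := volume) (a := 0) (b := L)
      (c := L - s) (hw.intervalIntegrable _ _) (hw.intervalIntegrable _ _)
    have h2 : v₀ + ∫ t in (0 : ℝ)..L, w t = 0 := hv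
    simp only [primitiveFrom, intervalIntegral.integral_comp_sub_left (fun t => w t), sub_zero]
    linarith
  have hval : ∀ s, primitiveFrom 0 (primitiveFrom 0 fun t => w (L - t)) s =
      primitiveFrom 0 (primitiveFrom v₀ w) (L - s) := by
    intro s
    have hi : ∀ a b, IntervalIntegrable (primitiveFrom v₀ w) volume a b := fun a b =>
      (continuous_primitiveFrom hw v₀).intervalIntegrable a b
    have h1 := intervalIntegral.integral_interval_sub_left (μ := volume) (a := 0) (b := L)
      (c := L - s) (hi _ _) (hi _ _)
    have h2 : 0 + ∫ t in (0 : ℝ)..L, primitiveFrom v₀ w t = 0 := hy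
    rw [primitiveFrom]
    simp only [hslope]
    rw [intervalIntegral.integral_neg,
      intervalIntegral.integral_comp_sub_left (fun t => primitiveFrom v₀ w t), sub_zero,
      primitiveFrom]
    linarith
  have hz := primitiveFrom_primitiveFrom_eq_zero (L := L) hw' hM (by
    have := (Measure.measurePreserving_sub_left volume L).quasiMeasurePreserving.ae h
    filter_upwards [this] with x hx hxL
    rw [hval]
    exact hx ⟨by linarith [hxL.2], by linarith [hxL.1]⟩)
  intro x hx
  have := hz (L - x) ⟨by linarith [hx.2], by linarith [hx.1]⟩
  rwa [hval, sub_sub_cancel] at this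

/-! ### Weak derivatives in one variable -/

theorem intervalIntegral_eq_integral_intervalMeasure {x : ℝ} (hx : 0 ≤ x) (f : ℝ → ℝ) :
    ∫ t in (0 : ℝ)..x, f t = ∫ t, f t ∂intervalMeasure x := by
  rw [intervalIntegral.integral_of_le hx, integral_Ioc_eq_integral_Ioo]

theorem MeasureTheory.MemLp.integrable_intervalMeasure {L : ℝ} {f : ℝ → ℝ}
    (hf : MemLp f 2 (intervalMeasure L)) : Integrable f (intervalMeasure L) :=
  hf.integrable (by norm_num)

theorem IsTestFunction.eq_zero_of_notMem {L x : ℝ} {φ : ℝ → ℝ} (hφ : IsTestFunction L φ)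
    (hx : x ∉ Ioo 0 L) : φ x = 0 :=
  image_eq_zero_of_notMem_tsupport fun h => hx (hφ.2.2 h)

theorem IsTestFunction.continuous_deriv {L : ℝ} {φ : ℝ → ℝ} (hφ : IsTestFunction L φ) :
    Continuous (deriv φ) :=
  hφ.1.continuous_deriv (by simp)

theorem IsTestFunction.hasDerivAt {L : ℝ} {φ : ℝ → ℝ} (hφ : IsTestFunction L φ) (x : ℝ) :
    HasDerivAt φ (deriv φ x) x :=
  (hφ.1.differentiable (by simp) x).hasDerivAt

theorem MeasureTheory.Integrable.mul_continuous {L : ℝ} {f φ : ℝ → ℝ}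
    (hf : Integrable f (intervalMeasure L)) (hφ : Continuous φ) :
    Integrable (fun x => f x * φ x) (intervalMeasure L) := by
  obtain ⟨C, hC⟩ := isCompact_Icc.exists_bound_of_continuousOn (s := Icc 0 L) hφ.continuousOn
  refine hf.mul_bdd (c := C) hφ.aestronglyMeasurable ?_
  exact (ae_restrict_iff' measurableSet_Ioo).2
    (Eventually.of_forall fun x hx => hC x (Ioo_subset_Icc_self hx))

/-- The fundamental lemma of the calculus of variations on `(0, L)`. -/
theorem ae_eq_zero_of_forall_isTestFunction {L : ℝ} {f : ℝ → ℝ}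
    (hf : Integrable f (intervalMeasure L))
    (h : ∀ φ, IsTestFunction L φ → ∫ x, f x * φ x ∂intervalMeasure L = 0) :
    f =ᵐ[intervalMeasure L] 0 := by
  refine (ae_restrict_iff' measurableSet_Ioo).2 ?_
  refine isOpen_Ioo.ae_eq_zero_of_integral_contDiff_smul_eq_zero
    (IntegrableOn.locallyIntegrableOn hf) fun g hg1 hg2 hg3 => ?_
  rw [← h g ⟨hg1, hg2, hg3⟩, ← setIntegral_eq_integral_of_forall_compl_eq_zero (s := Ioo 0 L)]
  · simp only [smul_eq_mul, mul_comm]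
  · intro x hx
    rw [IsTestFunction.eq_zero_of_notMem ⟨hg1, hg2, hg3⟩ hx, zero_smul]

/-- A test function of integral zero is the derivative of a test function. -/
theorem IsTestFunction.exists_deriv_eq {L : ℝ} {θ : ℝ → ℝ} (hθ : IsTestFunction L θ)
    (h0 : ∫ x in (0 : ℝ)..L, θ x = 0) : ∃ φ, IsTestFunction L φ ∧ deriv φ = θ := by
  rcases le_or_gt L 0 with hL | hL
  · refine ⟨0, ⟨contDiff_const, HasCompactSupport.zero, by simp⟩, ?_⟩
    ext x
    rw [hθ.eq_zero_of_notMem (by simp [hL.not_gt, Ioo_eq_empty])]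
    simp
  obtain ⟨a, b, ha, hb, hab⟩ : ∃ a b, 0 < a ∧ b < L ∧ tsupport θ ⊆ Icc a b := by
    rcases (tsupport θ).eq_empty_or_nonempty with he | hne
    · exact ⟨1, L - 1, one_pos, by linarith, by simp [he]⟩
    · obtain ⟨a, ha⟩ := IsCompact.exists_isLeast hθ.2.1 hne
      obtain ⟨b, hb⟩ := IsCompact.exists_isGreatest hθ.2.1 hne
      exact ⟨a, b, (hθ.2.2 ha.1).1, (hθ.2.2 hb.1).2, fun x hx => ⟨ha.2 hx, hb.2 hx⟩⟩
  have hz : ∀ x, x ∉ Icc a b → θ x = 0 := fun x hx =>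
    image_eq_zero_of_notMem_tsupport fun h => hx (hab h)
  have hc : Continuous θ := hθ.1.continuous
  have hd : ∀ x, HasDerivAt (primitiveFrom 0 θ) (θ x) x := hasDerivAt_primitiveFrom hc 0
  have hderiv : deriv (primitiveFrom 0 θ) = θ := funext fun x => (hd x).deriv
  have hsupp : ∀ x, x ∉ Icc a b → primitiveFrom 0 θ x = 0 := by
    intro x hx
    rw [primitiveFrom, zero_add]
    rcases lt_or_ge x a with hxa | hxa
    · refine intervalIntegral.integral_zero_ae (Eventually.of_forall fun t ht => hz t fun h => ?_)
      rcases mem_uIoc.1 ht with ht | ht <;> linarith [ht.1, ht.2, h.1]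
    · have hxb : b < x := not_le.1 fun h => hx ⟨hxa, h⟩
      have h1 := intervalIntegral.integral_add_adjacent_intervals (μ := volume)
        (hc.intervalIntegrable 0 L) (hc.intervalIntegrable L x)
      rw [← h1, h0, zero_add]
      refine intervalIntegral.integral_zero_ae (Eventually.of_forall fun t ht => hz t fun h => ?_)
      rcases mem_uIoc.1 ht with ht | ht <;> linarith [ht.1, ht.2, h.2]
  have hts : tsupport (primitiveFrom 0 θ) ⊆ Icc a b :=
    closure_minimal (fun x hx => by_contra fun h => hx (hsupp x h)) isClosed_Icc
  refine ⟨primitiveFrom 0 θ, ⟨?_, ?_, ?_⟩, hderiv⟩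
  · rw [contDiff_infty_iff_deriv, hderiv]
    exact ⟨fun x => (hd x).differentiableAt, hθ.1⟩
  · exact isCompact_Icc.of_isClosed_subset (isClosed_tsupport _) hts
  · exact hts.trans fun x hx => ⟨ha.trans_le hx.1, hx.2.trans_lt hb⟩

/-- The du Bois-Reymond lemma: a function whose weak derivative is zero is constant. -/
theorem exists_ae_eq_const_of_forall_isTestFunction {L : ℝ} (hL : 0 < L) {f : ℝ → ℝ}
    (hf : Integrable f (intervalMeasure L))
    (h : ∀ φ, IsTestFunction L φ → ∫ x, f x * deriv φ x ∂intervalMeasure L = 0) :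
    ∃ C, f =ᵐ[intervalMeasure L] fun _ => C := by
  let b : ContDiffBump (L / 2) := ⟨L / 8, L / 4, by positivity, by linarith⟩
  set η : ℝ → ℝ := b.normed volume with hη_def
  have hη : IsTestFunction L η := by
    refine ⟨b.contDiff_normed, b.hasCompactSupport_normed, ?_⟩
    rw [hη_def, b.tsupport_normed_eq, Real.closedBall_eq_Icc]
    intro x hx
    have h1 : L / 2 - L / 4 ≤ x := hx.1
    have h2 : x ≤ L / 2 + L / 4 := hx.2
    exact ⟨by linarith, by linarith⟩
  have hη1 : ∫ x, η x ∂intervalMeasure L = 1 := by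
    rw [setIntegral_eq_integral_of_forall_compl_eq_zero fun x hx => hη.eq_zero_of_notMem hx]
    exact b.integral_normed
  refine ⟨∫ x, f x * η x ∂intervalMeasure L, ?_⟩
  set C := ∫ x, f x * η x ∂intervalMeasure L with hC
  have key : (fun x => f x - C) =ᵐ[intervalMeasure L] 0 := by
    refine ae_eq_zero_of_forall_isTestFunction (hf.sub (integrable_const C)) fun ψ hψ => ?_
    set I := ∫ x, ψ x ∂intervalMeasure L with hI
    have hcont : ∀ g : ℝ → ℝ, Continuous g → Integrable g (intervalMeasure L) := fun g hg => by
      simpa using (integrable_const (μ := intervalMeasure L) (1 : ℝ)).mul_continuous hg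
    have hθ : IsTestFunction L fun x => ψ x - I * η x := by
      refine ⟨hψ.1.sub (contDiff_const.mul hη.1), hψ.2.1.sub hη.2.1.mul_left, ?_⟩
      refine (tsupport_sub _ _).trans (union_subset hψ.2.2 ?_)
      exact (tsupport_mul_subset_right (f := fun _ => I) (g := η)).trans hη.2.2
    obtain ⟨φ, hφ, hφθ⟩ := hθ.exists_deriv_eq (by
      rw [intervalIntegral_eq_integral_intervalMeasure hL.le, integral_sub
        (hcont _ hψ.1.continuous) ((hcont _ hη.1.continuous).const_mul I), integral_const_mul, hη1]
      simp [hI])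
    have h1 := h φ hφ
    rw [hφθ] at h1
    have h2 : ∀ x, f x * (ψ x - I * η x) = f x * ψ x - I * (f x * η x) := fun x => by ring
    simp only [h2] at h1
    rw [integral_sub (hf.mul_continuous hψ.1.continuous)
      ((hf.mul_continuous hη.1.continuous).const_mul I), integral_const_mul, ← hC] at h1
    simp only [sub_mul]
    rw [integral_sub (hf.mul_continuous hψ.1.continuous)
      ((hcont _ hψ.1.continuous).const_mul C), integral_const_mul, ← hI]
    linarith
  filter_upwards [key] with x hx
  simpa [sub_eq_zero] using hx

theorem locallyIntegrable_indicator {L : ℝ} {w : ℝ → ℝ} (hw : Integrable w (intervalMeasure L)) :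
    LocallyIntegrable ((Ioo 0 L).indicator w) :=
  ((integrable_indicator_iff measurableSet_Ioo).2 hw).locallyIntegrable

theorem HasWeakDerivL2.exists_ae_eq_primitiveFrom {L : ℝ} (hL : 0 < L) {u v : ℝ → ℝ}
    (h : HasWeakDerivL2 L u v) :
    ∃ C, u =ᵐ[intervalMeasure L] primitiveFrom C ((Ioo 0 L).indicator v) := by
  obtain ⟨hu, hv, hweak⟩ := h
  have hvl := locallyIntegrable_indicator hv.integrable_intervalMeasure
  set V := primitiveFrom 0 ((Ioo 0 L).indicator v) with hV
  have hVc : Continuous V := continuous_primitiveFrom hvl 0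
  have hVi : Integrable V (intervalMeasure L) := by
    simpa using (integrable_const (μ := intervalMeasure L) (1 : ℝ)).mul_continuous hVc
  obtain ⟨C, hC⟩ := exists_ae_eq_const_of_forall_isTestFunction (f := fun x => u x - V x) hL
    (hu.integrable_intervalMeasure.sub hVi) (by
      intro φ hφ
      simp only [sub_mul]
      rw [integral_sub (hu.integrable_intervalMeasure.mul_continuous hφ.continuous_deriv)
        (hVi.mul_continuous hφ.continuous_deriv), hweak φ hφ,
        ← intervalIntegral_eq_integral_intervalMeasure hL.le (fun x => V x * deriv φ x), hV,
        integral_primitiveFrom_mul_deriv hvl hφ.hasDerivAt hφ.continuous_deriv,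
        hφ.eq_zero_of_notMem (x := 0) (by simp), hφ.eq_zero_of_notMem (x := L) (by simp),
        intervalIntegral_eq_integral_intervalMeasure hL.le]
      have : ∫ x, (Ioo 0 L).indicator v x * φ x ∂intervalMeasure L =
          ∫ x, v x * φ x ∂intervalMeasure L :=
        setIntegral_congr_fun measurableSet_Ioo fun x hx => by
          simp only [indicator_of_mem hx]
      rw [this]
      ring)
  refine ⟨C, ?_⟩
  filter_upwards [hC] with x hx
  have : primitiveFrom C ((Ioo 0 L).indicator v) x = C + V x := by simp [hV, primitiveFrom]
  linarith

theorem HasWeakDerivL2.ae_unique {L : ℝ} {u v v' : ℝ → ℝ} (h : HasWeakDerivL2 L u v)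
    (h' : HasWeakDerivL2 L u v') : v =ᵐ[intervalMeasure L] v' := by
  have hv := h.2.1.integrable_intervalMeasure
  have hv' := h'.2.1.integrable_intervalMeasure
  have : (fun x => v x - v' x) =ᵐ[intervalMeasure L] 0 := by
    refine ae_eq_zero_of_forall_isTestFunction (hv.sub hv') fun φ hφ => ?_
    simp only [sub_mul]
    rw [integral_sub (hv.mul_continuous hφ.1.continuous) (hv'.mul_continuous hφ.1.continuous)]
    linarith [h.2.2 φ hφ, h'.2.2 φ hφ]
  filter_upwards [this] with x hx
  simpa [sub_eq_zero] using hx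

theorem primitiveFrom_congr_ae {L C x : ℝ} {w w' : ℝ → ℝ} (h : w =ᵐ[intervalMeasure L] w')
    (hx : x ∈ Icc 0 L) : primitiveFrom C w x = primitiveFrom C w' x := by
  rw [primitiveFrom, primitiveFrom, intervalIntegral_eq_integral_intervalMeasure hx.1,
    intervalIntegral_eq_integral_intervalMeasure hx.1]
  congr 1
  exact integral_congr_ae (ae_mono (Measure.restrict_mono_set _ (Ioo_subset_Ioo_right hx.2)) h)

theorem eqOn_Icc_of_ae_eq_intervalMeasure {L : ℝ} (hL : 0 < L) {f g : ℝ → ℝ}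
    (hf : ContinuousOn f (Icc 0 L)) (hg : ContinuousOn g (Icc 0 L))
    (h : f =ᵐ[intervalMeasure L] g) : EqOn f g (Icc 0 L) := by
  refine Measure.eqOn_Icc_of_ae_eq volume hL.ne ?_ hf hg
  rwa [← restrict_Ioo_eq_restrict_Icc]

/-- A continuous function of `H¹₀(0, L)` is the primitive vanishing at `0` of its weak derivative,
and vanishes at `L`: both properties pass to the limit from test functions. -/
theorem MemH10.exists_eqOn_primitiveFrom {L : ℝ} (hL : 0 < L) {u : ℝ → ℝ}
    (hu : ContinuousOn u (Icc 0 L)) (h : MemH10 L u) :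
    ∃ v, HasWeakDerivL2 L u v ∧ EqOn u (primitiveFrom 0 ((Ioo 0 L).indicator v)) (Icc 0 L) ∧
      u L = 0 := by
  obtain ⟨v, hw, φ, hφ, hu2, hv2⟩ := h
  have hvi := hw.2.1.integrable_intervalMeasure
  have hvl := locallyIntegrable_indicator hvi
  have hcont : ∀ g : ℝ → ℝ, Continuous g → Integrable g (intervalMeasure L) := fun g hg => by
    simpa using (integrable_const (μ := intervalMeasure L) (1 : ℝ)).mul_continuous hg
  have h1 : Tendsto (fun k => eLpNorm (deriv (φ k) - v) 1 (intervalMeasure L)) atTop (𝓝 0) := by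
    have hb : ∀ k, eLpNorm (deriv (φ k) - v) 1 (intervalMeasure L) ≤
        eLpNorm (fun x => deriv (φ k) x - v x) 2 (intervalMeasure L) *
          (intervalMeasure L) univ ^ (1 / (1 : ENNReal).toReal - 1 / (2 : ENNReal).toReal) :=
      fun k => eLpNorm_le_eLpNorm_mul_rpow_measure_univ (by norm_num)
        ((hφ k).continuous_deriv.aestronglyMeasurable.sub hw.2.1.1)
    have hlim := ENNReal.Tendsto.mul_const (b := (intervalMeasure L) univ ^
      (1 / (1 : ENNReal).toReal - 1 / (2 : ENNReal).toReal)) hv2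
      (Or.inr (by
        refine ENNReal.rpow_ne_top_of_nonneg (by norm_num) (measure_ne_top _ _)))
    rw [zero_mul] at hlim
    exact tendsto_of_tendsto_of_tendsto_of_le_of_le tendsto_const_nhds hlim (fun _ => bot_le) hb
  have hpt : ∀ x ∈ Icc 0 L, Tendsto (fun k => φ k x) atTop
      (𝓝 (primitiveFrom 0 ((Ioo 0 L).indicator v) x)) := by
    intro x hx
    have hset := tendsto_setIntegral_of_L1' (μ := intervalMeasure L) v hvi.aestronglyMeasurable
      (Eventually.of_forall fun k => hcont _ (hφ k).continuous_deriv) h1 (Ioo 0 x)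
    have hr : (intervalMeasure L).restrict (Ioo 0 x) = intervalMeasure x := by
      rw [intervalMeasure, Measure.restrict_restrict measurableSet_Ioo,
        inter_eq_left.2 (Ioo_subset_Ioo_right hx.2)]
    rw [hr] at hset
    have hlim : ∫ t, v t ∂intervalMeasure x = primitiveFrom 0 ((Ioo 0 L).indicator v) x := by
      rw [primitiveFrom, intervalIntegral_eq_integral_intervalMeasure hx.1, zero_add]
      refine setIntegral_congr_fun measurableSet_Ioo fun t ht => ?_
      exact (indicator_of_mem (s := Ioo 0 L) ⟨ht.1, ht.2.trans_le hx.2⟩ v).symm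
    rw [hlim] at hset
    refine hset.congr fun k => ?_
    rw [← intervalIntegral_eq_integral_intervalMeasure hx.1,
      intervalIntegral.integral_eq_sub_of_hasDerivAt (fun t _ => (hφ k).hasDerivAt t)
        ((hφ k).continuous_deriv.intervalIntegrable _ _),
      (hφ k).eq_zero_of_notMem (x := 0) (by simp), sub_zero]
  have hae : u =ᵐ[intervalMeasure L] primitiveFrom 0 ((Ioo 0 L).indicator v) := by
    have hm := tendstoInMeasure_of_tendsto_eLpNorm (p := 2) (by norm_num)
      (fun k => (hφ k).1.continuous.aestronglyMeasurable) hw.1.1 hu2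
    obtain ⟨ns, hns, hlim⟩ := hm.exists_seq_tendsto_ae
    filter_upwards [hlim, ae_restrict_mem measurableSet_Ioo] with x hx hxL
    exact tendsto_nhds_unique hx ((hpt x (Ioo_subset_Icc_self hxL)).comp hns.tendsto_atTop)
  have heq := eqOn_Icc_of_ae_eq_intervalMeasure hL hu
    (continuous_primitiveFrom hvl 0).continuousOn hae
  refine ⟨v, hw, heq, ?_⟩
  rw [heq (right_mem_Icc.2 hL.le)]
  refine tendsto_nhds_unique (hpt L (right_mem_Icc.2 hL.le)) ?_
  simp only [fun k => (hφ k).eq_zero_of_notMem (x := L) (by simp)]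
  exact tendsto_const_nhds

/-- A continuous function `u` in the domain of `𝒜` is a classical solution of `u'' = w`,
`u(0) = u(L) = 0`, with `w + c u` representing `𝒜 u`. -/
theorem IsOperatorImage.exists_eqOn_primitiveFrom {L : ℝ} (hL : 0 < L) {c u f : ℝ → ℝ}
    (hu : ContinuousOn u (Icc 0 L)) (h : IsOperatorImage L c u f) :
    ∃ w : ℝ → ℝ, LocallyIntegrable w ∧
      (f =ᵐ[intervalMeasure L] fun x => w x + c x * u x) ∧
      EqOn u (primitiveFrom 0 (primitiveFrom (derivWithin u (Icc 0 L) 0) w)) (Icc 0 L) ∧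
      u L = 0 := by
  obtain ⟨-, h10, v, w, huv, hvw, hf⟩ := h
  obtain ⟨v', huv', heq, huL⟩ := h10.exists_eqOn_primitiveFrom hL hu
  obtain ⟨C, hC⟩ := hvw.exists_ae_eq_primitiveFrom hL
  have hwl := locallyIntegrable_indicator hvw.2.1.integrable_intervalMeasure
  set w' := (Ioo 0 L).indicator w with hw'
  have hind : ∀ g : ℝ → ℝ, (Ioo 0 L).indicator g =ᵐ[intervalMeasure L] g := fun g =>
    (ae_restrict_iff' measurableSet_Ioo).2 (Eventually.of_forall fun x hx => indicator_of_mem hx g)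
  have heq' : EqOn u (primitiveFrom 0 (primitiveFrom C w')) (Icc 0 L) := fun x hx => by
    rw [heq hx]
    exact primitiveFrom_congr_ae ((hind v').trans ((huv'.ae_unique huv).trans hC)) hx
  have hderiv : derivWithin u (Icc 0 L) 0 = C := by
    have h0 : (0 : ℝ) ∈ Icc 0 L := left_mem_Icc.2 hL.le
    have h1 := (hasDerivAt_primitiveFrom (continuous_primitiveFrom hwl C) 0 0).hasDerivWithinAt
      (s := Icc 0 L)
    rw [primitiveFrom_zero] at h1
    exact (h1.congr heq' (heq' h0)).derivWithin (uniqueDiffOn_Icc hL 0 h0)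
  refine ⟨w', hwl, ?_, hderiv ▸ heq', huL⟩
  filter_upwards [hf, hind w] with x hx hx'
  rw [hx, hw', hx']

/-! ### Green's formula for the eigenfunctions -/

theorem MeasureTheory.MemLp.exists_ae_abs_le {L : ℝ} {c : ℝ → ℝ}
    (hc : MemLp c ⊤ (intervalMeasure L)) :
    ∃ M, 0 ≤ M ∧ ∀ᵐ x ∂intervalMeasure L, |c x| ≤ M := by
  refine ⟨(eLpNorm c ⊤ (intervalMeasure L)).toReal, ENNReal.toReal_nonneg, ?_⟩
  have h := hc.2
  rw [eLpNorm_exponent_top] at h ⊢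
  filter_upwards [ae_le_eLpNormEssSup (f := c) (μ := intervalMeasure L)] with x hx
  rw [← Real.norm_eq_abs, ← toReal_enorm]
  exact ENNReal.toReal_mono h.ne hx

theorem Continuous.memLp_intervalMeasure {L : ℝ} {g : ℝ → ℝ} (hg : Continuous g)
    (p : ENNReal) : MemLp g p (intervalMeasure L) := by
  obtain ⟨C, hC⟩ := isCompact_Icc.exists_bound_of_continuousOn (s := Icc 0 L) hg.continuousOn
  exact MemLp.of_bound hg.aestronglyMeasurable C ((ae_restrict_iff' measurableSet_Ioo).2
    (Eventually.of_forall fun x hx => hC x (Ioo_subset_Icc_self hx)))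

theorem memLp_mul_continuous {L : ℝ} {c g : ℝ → ℝ} (hc : MemLp c ⊤ (intervalMeasure L))
    (hg : Continuous g) : MemLp (fun x => c x * g x) 2 (intervalMeasure L) :=
  (hg.memLp_intervalMeasure 2).mul hc

/-- Green's formula `⟨φ'' + c φ, e⟩ = e'(0) φ(0) - e'(L) φ(L) + μ ⟨φ, e⟩` for a nonzero
eigenfunction `e` of eigenvalue `μ`, together with `e'(L) ≠ 0`, which holds by uniqueness for the
Cauchy problem at `L`. The number `s` is `e'(L)`. -/
theorem IsOperatorImage.exists_green {L : ℝ} (hL : 0 < L) {c u : ℝ → ℝ} {μ : ℝ}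
    (hc : MemLp c ⊤ (intervalMeasure L)) (hu : ContinuousOn u (Icc 0 L))
    (h : IsOperatorImage L c u fun x => μ * u x) (hne : ¬ u =ᵐ[intervalMeasure L] 0) :
    ∃ s ≠ 0, ∀ φ φ' φ'' : ℝ → ℝ, (∀ x, HasDerivAt φ (φ' x) x) → (∀ x, HasDerivAt φ' (φ'' x) x) →
      Continuous φ'' → ∫ x, (φ'' x + c x * φ x) * u x ∂intervalMeasure L =
        derivWithin u (Icc 0 L) 0 * φ 0 - s * φ L + μ * ∫ x, φ x * u x ∂intervalMeasure L := by
  obtain ⟨w, hw, hwu, heq, huL⟩ := h.exists_eqOn_primitiveFrom hL hu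
  set v₀ := derivWithin u (Icc 0 L) 0
  set y := primitiveFrom 0 (primitiveFrom v₀ w) with hy
  have hyc : Continuous y :=
    continuous_primitiveFrom (continuous_primitiveFrom hw v₀).locallyIntegrable 0
  have huy : u =ᵐ[intervalMeasure L] y := (ae_restrict_iff' measurableSet_Ioo).2
    (Eventually.of_forall fun x hx => heq (Ioo_subset_Icc_self hx))
  have hyL : y L = 0 := by rw [← heq (right_mem_Icc.2 hL.le), huL]
  have hwy : w =ᵐ[intervalMeasure L] fun x => μ * y x - c x * y x := by
    filter_upwards [hwu, huy] with x h1 h2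
    rw [← h2]; linarith
  refine ⟨primitiveFrom v₀ w L, fun hs => hne ?_, fun φ φ' φ'' hφ hφ' hφ'' => ?_⟩
  · obtain ⟨M, hM, hcM⟩ := hc.exists_ae_abs_le
    have hzero := primitiveFrom_primitiveFrom_eq_zero_of_right (M := |μ| + M) hw (by positivity)
      (by
        refine (ae_restrict_iff' measurableSet_Ioo).1 ?_
        filter_upwards [hwy, hcM] with x h1 h2
        rw [h1, ← sub_mul, abs_mul]
        exact mul_le_mul_of_nonneg_right ((abs_sub _ _).trans (by linarith)) (abs_nonneg _))
      hyL hs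
    exact (ae_restrict_iff' measurableSet_Ioo).2 (Eventually.of_forall fun x hx => by
      rw [heq (Ioo_subset_Icc_self hx)]
      exact hzero x (Ioo_subset_Icc_self hx))
  · have hφc : Continuous φ := continuous_iff_continuousAt.2 fun x => (hφ x).continuousAt
    have hG := integral_primitiveFrom_primitiveFrom_mul hw hφ hφ' hφ'' v₀ L
    rw [← hy, hyL, intervalIntegral_eq_integral_intervalMeasure hL.le,
      intervalIntegral_eq_integral_intervalMeasure hL.le] at hG
    have hci : Integrable c (intervalMeasure L) := hc.integrable le_top
    have hi1 : Integrable (fun x => y x * φ'' x) (intervalMeasure L) :=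
      ((hyc.mul hφ'').memLp_intervalMeasure 1).integrable le_rfl
    have hi2 : Integrable (fun x => φ x * y x) (intervalMeasure L) :=
      ((hφc.mul hyc).memLp_intervalMeasure 1).integrable le_rfl
    have hi3 : Integrable (fun x => c x * (φ x * y x)) (intervalMeasure L) :=
      hci.mul_continuous (hφc.mul hyc)
    have e1 : ∫ x, (φ'' x + c x * φ x) * u x ∂intervalMeasure L =
        ∫ x, y x * φ'' x ∂intervalMeasure L + ∫ x, c x * (φ x * y x) ∂intervalMeasure L := by
      rw [← integral_add hi1 hi3]
      refine integral_congr_ae ?_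
      filter_upwards [huy] with x hx
      rw [hx]; ring
    have e2 : ∫ x, φ x * u x ∂intervalMeasure L = ∫ x, φ x * y x ∂intervalMeasure L := by
      refine integral_congr_ae ?_
      filter_upwards [huy] with x hx
      rw [hx]
    have e3 : ∫ x, w x * φ x ∂intervalMeasure L = μ * ∫ x, φ x * y x ∂intervalMeasure L
        - ∫ x, c x * (φ x * y x) ∂intervalMeasure L := by
      rw [← integral_const_mul, ← integral_sub (hi2.const_mul μ) hi3]
      refine integral_congr_ae ?_
      filter_upwards [hwy] with x hx
      rw [hx]; ring
    rw [e1, e2]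
    linarith

section Modes

variable {L : ℝ} {c : ℝ → ℝ} {lam : ℕ → ℝ} {e : ℕ → ℝ → ℝ}

theorem IsEigenbasis.not_ae_eq_zero (he : IsEigenbasis L c lam e) (j : ℕ) :
    ¬ e j =ᵐ[intervalMeasure L] 0 := by
  obtain ⟨b, hb⟩ := he.hilbertBasis
  intro h0
  refine b.orthonormal.ne_zero j (Lp.ext ?_)
  exact ((hb j).trans h0).trans (Lp.coeFn_zero ℝ 2 (intervalMeasure L)).symm

theorem IsEigenbasis.exists_green (hL : 0 < L) (hc : MemLp c ⊤ (intervalMeasure L))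
    (he : IsEigenbasis L c lam e) (j : ℕ) :
    ∃ s ≠ 0, ∀ φ φ' φ'' : ℝ → ℝ, (∀ x, HasDerivAt φ (φ' x) x) → (∀ x, HasDerivAt φ' (φ'' x) x) →
      Continuous φ'' → ∫ x, (φ'' x + c x * φ x) * e j x ∂intervalMeasure L =
        leftTrace L e j * φ 0 - s * φ L + lam j * ∫ x, φ x * e j x ∂intervalMeasure L :=
  (he.eigen j).exists_green hL hc (he.continuousOn j) (he.not_ae_eq_zero j)

theorem coeffA_eq (hL : 0 < L) (j : ℕ) :
    coeffA L c e j = ∫ x, (c x * (x / L)) * e j x ∂intervalMeasure L := by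
  rw [coeffA, intervalIntegral_eq_integral_intervalMeasure hL.le, ← integral_const_mul]
  congr 1 with x
  ring

theorem coeffB_eq (hL : 0 < L) (j : ℕ) :
    coeffB L e j = -∫ x, (x / L) * e j x ∂intervalMeasure L := by
  rw [coeffB, intervalIntegral_eq_integral_intervalMeasure hL.le, ← integral_const_mul,
    ← integral_neg]
  congr 1 with x
  ring

/-- Green's formula with `φ(x) = x / L` reads `a_j + λ_j b_j = -e_j'(L)`. -/
theorem coeffA_add_mul_coeffB_ne_zero (hL : 0 < L) (hc : MemLp c ⊤ (intervalMeasure L))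
    (he : IsEigenbasis L c lam e) (j : ℕ) : coeffA L c e j + lam j * coeffB L e j ≠ 0 := by
  obtain ⟨s, hs, hg⟩ := he.exists_green hL hc j
  have h1 := hg (fun x => x / L) (fun _ => 1 / L) (fun _ => 0)
    (fun x => (hasDerivAt_id x).div_const L) (fun x => hasDerivAt_const x _) continuous_const
  simp only [zero_add, zero_div, mul_zero, zero_sub, div_self hL.ne', mul_one] at h1
  rw [← coeffA_eq hL] at h1
  rw [coeffB_eq hL, h1]
  intro h2
  apply hs
  linarith

/-- Green's formula with `φ(x) = 1 - x / L` expresses the trace `e_j'(0)` through Fourier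
coefficients. -/
theorem leftTrace_eq (hL : 0 < L) (hc : MemLp c ⊤ (intervalMeasure L))
    (he : IsEigenbasis L c lam e) (j : ℕ) :
    leftTrace L e j = ∫ x, (c x * (1 - x / L)) * e j x ∂intervalMeasure L
      - lam j * ∫ x, (1 - x / L) * e j x ∂intervalMeasure L := by
  obtain ⟨s, -, hg⟩ := he.exists_green hL hc j
  have h1 := hg (fun x => 1 - x / L) (fun _ => -(1 / L)) (fun _ => 0)
    (fun x => ((hasDerivAt_id x).div_const L).const_sub 1) (fun x => hasDerivAt_const x _)
    continuous_const
  simp only [zero_add, zero_div, mul_zero, sub_zero, div_self hL.ne', mul_one, sub_self] at h1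
  linarith

/-! ### Fourier coefficients and convergence of the series -/

variable {b : HilbertBasis ℕ ℝ (L2Space L)}

theorem inner_toLp_eq_integral {f : ℝ → ℝ} (hb : ∀ j, b j =ᵐ[intervalMeasure L] e j)
    (hf : MemLp f 2 (intervalMeasure L)) (j : ℕ) :
    inner ℝ (hf.toLp f) (b j) = ∫ x, f x * e j x ∂intervalMeasure L := by
  rw [L2.inner_def]
  refine integral_congr_ae ?_
  filter_upwards [hb j, hf.coeFn_toLp] with x h1 h2
  rw [h1, h2]
  simp [mul_comm]

theorem IsEigenbasis.summable_sq_integral (he : IsEigenbasis L c lam e) {f : ℝ → ℝ}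
    (hf : MemLp f 2 (intervalMeasure L)) :
    Summable fun j => (∫ x, f x * e j x ∂intervalMeasure L) ^ 2 := by
  obtain ⟨b, hb⟩ := he.hilbertBasis
  have := b.summable_inner_mul_inner (hf.toLp f) (hf.toLp f)
  refine this.congr fun j => ?_
  rw [real_inner_comm (hf.toLp f) (b j), inner_toLp_eq_integral hb, sq]

theorem summable_mul_of_summable_sq {p q : ℕ → ℝ} (hp : Summable fun k => p k ^ 2)
    (hq : Summable fun k => q k ^ 2) : Summable fun k => p k * q k := by
  refine Summable.of_norm_bounded (hp.add hq) fun k => ?_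
  rw [Real.norm_eq_abs, abs_le]
  constructor <;> nlinarith [sq_nonneg (p k + q k), sq_nonneg (p k - q k), sq_nonneg (p k)]

theorem IsEigenbasis.summable_sq_coeffA (hL : 0 < L) (hc : MemLp c ⊤ (intervalMeasure L))
    (he : IsEigenbasis L c lam e) : Summable fun j => coeffA L c e j ^ 2 := by
  simp only [coeffA_eq hL]
  exact he.summable_sq_integral (memLp_mul_continuous hc (by fun_prop))

theorem IsEigenbasis.summable_sq_coeffB (hL : 0 < L)
    (he : IsEigenbasis L c lam e) : Summable fun j => coeffB L e j ^ 2 := by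
  simp only [coeffB_eq hL, neg_sq]
  exact he.summable_sq_integral (Continuous.memLp_intervalMeasure (by fun_prop) 2)

theorem IsEigenbasis.abs_inv_le (he : IsEigenbasis L c lam e) {n : ℕ} (hn : lam n < 0) (k : ℕ) :
    |(lam (n + k))⁻¹| ≤ |lam n|⁻¹ := by
  have h := he.strictAnti.antitone (Nat.le_add_right n k)
  rw [abs_inv]
  refine inv_anti₀ (abs_pos.2 hn.ne) ?_
  rw [abs_of_neg hn, abs_of_neg (h.trans_lt hn)]
  linarith

/-- The sequence `e_j'(0) / λ_j` is square summable over the negative eigenvalues. -/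
theorem IsEigenbasis.summable_sq_leftTrace_div (hL : 0 < L)
    (hc : MemLp c ⊤ (intervalMeasure L)) (he : IsEigenbasis L c lam e) {n : ℕ} (hn : lam n < 0) :
    Summable fun k => (leftTrace L e (n + k) / lam (n + k)) ^ 2 := by
  have hinj : Function.Injective fun k => n + k := add_right_injective n
  have h1 := (he.summable_sq_integral (memLp_mul_continuous hc
    (g := fun x => 1 - x / L) (by fun_prop))).comp_injective hinj
  have h2 := (he.summable_sq_integral (Continuous.memLp_intervalMeasure
    (g := fun x => 1 - x / L) (by fun_prop) 2)).comp_injective hinj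
  refine Summable.of_nonneg_of_le (fun k => sq_nonneg _) (fun k => ?_)
    ((h1.mul_left (2 * |lam n|⁻¹ ^ 2)).add (h2.mul_left 2))
  have hk : lam (n + k) ≠ 0 :=
    ((he.strictAnti.antitone (Nat.le_add_right n k)).trans_lt hn).ne
  have hsq : (lam (n + k))⁻¹ ^ 2 ≤ |lam n|⁻¹ ^ 2 := by
    rw [← sq_abs (lam (n + k))⁻¹]
    exact pow_le_pow_left₀ (abs_nonneg _) (he.abs_inv_le hn k) 2
  rw [leftTrace_eq hL hc he, sub_div, mul_div_cancel_left₀ _ hk, div_eq_mul_inv]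
  simp only [Function.comp_apply]
  set p := ∫ x, (c x * (1 - x / L)) * e (n + k) x ∂intervalMeasure L
  set q := ∫ x, (1 - x / L) * e (n + k) x ∂intervalMeasure L
  have := mul_le_mul_of_nonneg_right hsq (sq_nonneg p)
  nlinarith [sq_nonneg (p * (lam (n + k))⁻¹ + q)]

theorem IsEigenbasis.summable_alphaTerm (hL : 0 < L) (hc : MemLp c ⊤ (intervalMeasure L))
    (he : IsEigenbasis L c lam e) {n : ℕ} (hn : lam n < 0) :
    Summable (alphaTerm L c lam e n) :=
  summable_mul_of_summable_sq (he.summable_sq_leftTrace_div hL hc hn)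
    ((he.summable_sq_coeffA hL hc).comp_injective (add_right_injective n))

theorem IsEigenbasis.summable_betaTerm (hL : 0 < L) (hc : MemLp c ⊤ (intervalMeasure L))
    (he : IsEigenbasis L c lam e) {n : ℕ} (hn : lam n < 0) :
    Summable (betaTerm L lam e n) :=
  summable_mul_of_summable_sq (he.summable_sq_leftTrace_div hL hc hn)
    ((he.summable_sq_coeffB hL).comp_injective (add_right_injective n))

end Modes

/-! ### The kernel of the block matrix -/

section Kernel

variable {L : ℝ} {c : ℝ → ℝ} {lam : ℕ → ℝ} {e : ℕ → ℝ → ℝ}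

theorem inner_toLp_toLp {f g : ℝ → ℝ} (hf : MemLp f 2 (intervalMeasure L))
    (hg : MemLp g 2 (intervalMeasure L)) :
    inner ℝ (hf.toLp f) (hg.toLp g) = ∫ x, f x * g x ∂intervalMeasure L := by
  rw [L2.inner_def]
  refine integral_congr_ae ?_
  filter_upwards [hg.coeFn_toLp, hf.coeFn_toLp] with x h1 h2
  rw [h1, h2]
  simp [mul_comm]

theorem memLp_add_mul {φ φ'' : ℝ → ℝ} (hc : MemLp c ⊤ (intervalMeasure L)) (hφ : Continuous φ)
    (hφ'' : Continuous φ'') : MemLp (fun x => φ'' x + c x * φ x) 2 (intervalMeasure L) :=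
  (hφ''.memLp_intervalMeasure 2).add (memLp_mul_continuous hc hφ)

/-- Green's formula for `x / L`, which vanishes at `0` and equals `1` at `L`. -/
theorem integral_mul_div_of_eq_zero (hL : 0 < L) (hc : MemLp c ⊤ (intervalMeasure L))
    {φ φ' φ'' : ℝ → ℝ} (hφ : ∀ x, HasDerivAt φ (φ' x) x) (hφ' : ∀ x, HasDerivAt φ' (φ'' x) x)
    (hφ'' : Continuous φ'') (hφL : φ L = 0) :
    ∫ x, (φ'' x + c x * φ x) * (x / L) ∂intervalMeasure L =
      φ' L + φ 0 / L + ∫ x, (c x * (x / L)) * φ x ∂intervalMeasure L := by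
  have hφc : Continuous φ := continuous_iff_continuousAt.2 fun x => (hφ x).continuousAt
  have hz : LocallyIntegrable (fun _ : ℝ => (0 : ℝ)) := locallyIntegrable_zero
  have hG := integral_primitiveFrom_primitiveFrom_mul hz hφ hφ' hφ'' (1 / L) L
  have hlin : ∀ x, primitiveFrom 0 (primitiveFrom (1 / L) fun _ => 0) x = x / L := fun x => by
    simp [primitiveFrom, div_eq_mul_inv]
  simp only [hlin, hφL, zero_mul, mul_zero, intervalIntegral.integral_zero, div_self hL.ne',
    one_mul, sub_zero, add_zero] at hG
  rw [intervalIntegral_eq_integral_intervalMeasure hL.le] at hG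
  have hi1 : Integrable (fun x => x / L * φ'' x) (intervalMeasure L) :=
    ((by fun_prop : Continuous fun x => x / L * φ'' x).memLp_intervalMeasure 1).integrable le_rfl
  have hi2 : Integrable (fun x => c x * (x / L) * φ x) (intervalMeasure L) :=
    ((hc.integrable le_top).mul_continuous (by fun_prop : Continuous fun x => x / L)).mul_continuous
      hφc
  have e1 : ∫ x, (φ'' x + c x * φ x) * (x / L) ∂intervalMeasure L =
      ∫ x, x / L * φ'' x ∂intervalMeasure L + ∫ x, c x * (x / L) * φ x ∂intervalMeasure L := by
    rw [← integral_add hi1 hi2]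
    congr 1 with x
    ring
  rw [e1, hG]
  ring

/-- Uniqueness for the Cauchy problem `u'' + c u = 0`, `u(0) = u'(0) = 0`, in the weakest sense:
an element of `L²(0, L)` orthogonal to `φ'' + c φ` for all `φ` with `φ(L) = φ'(L) = 0` is zero.
Taking `φ'' = g` arbitrary shows that `u` is minus the double primitive of `c u`. -/
theorem ae_eq_zero_of_forall_integral_eq_zero (hL : 0 < L) (hc : MemLp c ⊤ (intervalMeasure L))
    {u : ℝ → ℝ} (hu : MemLp u 2 (intervalMeasure L))
    (h : ∀ φ φ' φ'' : ℝ → ℝ, (∀ x, HasDerivAt φ (φ' x) x) → (∀ x, HasDerivAt φ' (φ'' x) x) →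
      Continuous φ'' → φ L = 0 → φ' L = 0 →
      ∫ x, (φ'' x + c x * φ x) * u x ∂intervalMeasure L = 0) :
    u =ᵐ[intervalMeasure L] 0 := by
  have hcu : Integrable (fun x => c x * u x) (intervalMeasure L) :=
    (hu.mul (r := 2) hc).integrable_intervalMeasure
  have hui := hu.integrable_intervalMeasure
  set w := (Ioo 0 L).indicator fun x => c x * u x with hw_def
  have hw : LocallyIntegrable w := locallyIntegrable_indicator hcu
  set y := primitiveFrom 0 (primitiveFrom 0 w) with hy
  have hyc : Continuous y :=
    continuous_primitiveFrom (continuous_primitiveFrom hw 0).locallyIntegrable 0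
  have hyi : Integrable y (intervalMeasure L) := (hyc.memLp_intervalMeasure 1).integrable le_rfl
  have hsum : (fun x => u x + y x) =ᵐ[intervalMeasure L] 0 := by
    refine ae_eq_zero_of_forall_isTestFunction (hui.add hyi) fun g hg => ?_
    have hgc := hg.1.continuous
    set φ' := primitiveFrom (-∫ t in (0 : ℝ)..L, g t) g with hφ'
    have hφ'd : ∀ x, HasDerivAt φ' (g x) x := hasDerivAt_primitiveFrom hgc _
    have hφ'c : Continuous φ' := continuous_primitiveFrom hgc.locallyIntegrable _
    set φ := primitiveFrom (-∫ t in (0 : ℝ)..L, φ' t) φ' with hφ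
    have hφd : ∀ x, HasDerivAt φ (φ' x) x := hasDerivAt_primitiveFrom hφ'c _
    have hφc : Continuous φ := continuous_primitiveFrom hφ'c.locallyIntegrable _
    have hφL : φ L = 0 := by simp [hφ, primitiveFrom]
    have hφ'L : φ' L = 0 := by simp [hφ', primitiveFrom]
    have h0 := h φ φ' g hφd hφ'd hgc hφL hφ'L
    have hG := integral_primitiveFrom_primitiveFrom_mul hw hφd hφ'd hgc 0 L
    rw [← hy, hφL, hφ'L, intervalIntegral_eq_integral_intervalMeasure hL.le,
      intervalIntegral_eq_integral_intervalMeasure hL.le] at hG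
    have e1 : ∫ x, w x * φ x ∂intervalMeasure L = ∫ x, (c x * u x) * φ x ∂intervalMeasure L :=
      setIntegral_congr_fun measurableSet_Ioo fun x hx => by
        simp only [hw_def, indicator_of_mem hx]
    have e2 : ∫ x, (g x + c x * φ x) * u x ∂intervalMeasure L =
        ∫ x, u x * g x ∂intervalMeasure L + ∫ x, (c x * u x) * φ x ∂intervalMeasure L := by
      rw [← integral_add (hui.mul_continuous hgc) (hcu.mul_continuous hφc)]
      congr 1 with x
      ring
    simp only [add_mul]
    rw [integral_add (hui.mul_continuous hgc) (hyi.mul_continuous hgc)]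
    linarith
  obtain ⟨M, hM, hcM⟩ := hc.exists_ae_abs_le
  have hy0 := primitiveFrom_primitiveFrom_eq_zero (L := L) hw hM (by
    refine (ae_restrict_iff' measurableSet_Ioo).1 ?_
    filter_upwards [hsum, hcM, ae_restrict_mem measurableSet_Ioo] with x h1 h2 h3
    have h4 : u x = -y x := eq_neg_of_add_eq_zero_left h1
    rw [hw_def, indicator_of_mem h3, h4, abs_mul, abs_neg]
    exact mul_le_mul_of_nonneg_right h2 (abs_nonneg _))
  filter_upwards [hsum, ae_restrict_mem measurableSet_Ioo] with x h1 h3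
  have h2 : y x = 0 := hy0 x (Ioo_subset_Icc_self h3)
  have h4 : u x + y x = 0 := h1
  rw [h2, add_zero] at h4
  exact h4

/-- The kernel of the block matrix is trivial. With `w_j = x_j` for `j < n` and
`w_j = -a_j x₀ / λ_j` for `j ≥ n`, the function `u = ∑ w_j e_j + x₀ x / L` solves `u'' + c u = 0`
with `u(0) = u'(0) = 0` and `u(L) = x₀`, all of it in the transposed sense
`⟨u, φ'' + c φ⟩ = x₀ φ'(L)` for every `φ` vanishing at `L`. Hence `u = 0`. -/
theorem IsEigenbasis.eq_zero_of_mem_kernel (hL : 0 < L) (hc : MemLp c ⊤ (intervalMeasure L))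
    (he : IsEigenbasis L c lam e) {n : ℕ} (hn : lam n < 0) {x₀ : ℝ} {x : Fin n → ℝ}
    (hx : ∀ j : Fin n, coeffA L c e j * x₀ + lam j * x j = 0)
    (htrace : alpha L c lam e n * x₀ + ∑ j : Fin n, leftTrace L e j * x j = 0) :
    x₀ = 0 ∧ ∀ j, x j = 0 := by
  obtain ⟨b, hb⟩ := he.hilbertBasis
  have hneg : ∀ k, lam (n + k) ≠ 0 := fun k =>
    ((he.strictAnti.antitone (Nat.le_add_right n k)).trans_lt hn).ne
  let w : ℕ → ℝ := fun j => if h : j < n then x ⟨j, h⟩ else -(coeffA L c e j * x₀ / lam j)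
  have hw_lt : ∀ j : Fin n, w j = x j := fun j => by simp [w]
  have hw_ge : ∀ k, w (n + k) = -(coeffA L c e (n + k) * x₀ / lam (n + k)) := fun k => by simp [w]
  have hlamw : ∀ j, lam j * w j = -(coeffA L c e j * x₀) := by
    intro j
    rcases lt_or_ge j n with hj | hj
    · have h1 := hw_lt ⟨j, hj⟩
      have h2 := hx ⟨j, hj⟩
      simp only at h1 h2
      rw [h1]
      linarith
    · obtain ⟨k, rfl⟩ := Nat.exists_eq_add_of_le hj
      rw [hw_ge]
      field_simp [hneg k]
  have hw_sq : Summable fun j => w j ^ 2 := by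
    refine (summable_nat_add_iff n).1 ?_
    refine Summable.of_nonneg_of_le (fun k => sq_nonneg _) (fun k => ?_)
      (((he.summable_sq_coeffA hL hc).comp_injective (add_right_injective n)).mul_left
        (x₀ ^ 2 * |lam n|⁻¹ ^ 2))
    have hsq : (lam (n + k))⁻¹ ^ 2 ≤ |lam n|⁻¹ ^ 2 := by
      rw [← sq_abs (lam (n + k))⁻¹]
      exact pow_le_pow_left₀ (abs_nonneg _) (he.abs_inv_le hn k) 2
    have := mul_le_mul_of_nonneg_right hsq (sq_nonneg (coeffA L c e (n + k) * x₀))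
    rw [add_comm k n, hw_ge, div_eq_mul_inv]
    simp only [Function.comp_apply]
    linarith
  have hw_trace : HasSum (fun j => leftTrace L e j * w j) (-(x₀ / L)) := by
    refine (hasSum_nat_add_iff' n).1 ?_
    have h1 := ((he.summable_alphaTerm hL hc hn).hasSum.mul_left (-x₀))
    have h2 : -x₀ * ∑' k, alphaTerm L c lam e n k =
        -(x₀ / L) - ∑ i ∈ Finset.range n, leftTrace L e i * w i := by
      rw [Finset.sum_range]
      simp only [hw_lt]
      have h3 : alpha L c lam e n = 1 / L - ∑' k, alphaTerm L c lam e n k := rfl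
      rw [h3] at htrace
      linear_combination htrace
    rw [← h2]
    refine h1.congr_fun fun k => ?_
    rw [add_comm k n, hw_ge, alphaTerm]
    ring
  let wl : lp (fun _ : ℕ => ℝ) 2 := ⟨w, memℓp_gen (by simpa using hw_sq)⟩
  let W : L2Space L := b.repr.symm wl
  have hW : ∀ j, inner ℝ (b j) W = w j := fun j => by
    rw [← b.repr_apply_apply]
    simp [W, wl]
  have hxc : Continuous fun t : ℝ => t / L := by fun_prop
  have hX := hxc.memLp_intervalMeasure (L := L) 2
  let U : L2Space L := W + x₀ • hX.toLp _
  have hkey : ∀ φ φ' φ'' : ℝ → ℝ, (∀ t, HasDerivAt φ (φ' t) t) →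
      (∀ t, HasDerivAt φ' (φ'' t) t) → Continuous φ'' → φ L = 0 →
      ∫ t, (φ'' t + c t * φ t) * U t ∂intervalMeasure L = x₀ * φ' L := by
    intro φ φ' φ'' hφ hφ' hφ'' hφL
    have hφc : Continuous φ := continuous_iff_continuousAt.2 fun t => (hφ t).continuousAt
    have hF := memLp_add_mul hc hφc hφ''
    have hΦ := hφc.memLp_intervalMeasure (L := L) 2
    have hA := memLp_mul_continuous hc hxc
    have hcoef : ∀ j, inner ℝ (hF.toLp _) (b j) =
        leftTrace L e j * φ 0 + lam j * inner ℝ (hΦ.toLp _) (b j) := by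
      intro j
      obtain ⟨s, -, hs⟩ := he.exists_green hL hc j
      rw [inner_toLp_eq_integral hb, inner_toLp_eq_integral hb, hs φ φ' φ'' hφ hφ' hφ'', hφL]
      ring
    have h1 : HasSum (fun j => inner ℝ (hF.toLp _) (b j) * inner ℝ (b j) W)
        (φ 0 * -(x₀ / L) + -x₀ * inner ℝ (hA.toLp _) (hΦ.toLp _)) := by
      refine ((hw_trace.mul_left (φ 0)).add
        ((b.hasSum_inner_mul_inner (hA.toLp _) (hΦ.toLp _)).mul_left (-x₀))).congr_fun fun j => ?_
      rw [hcoef, hW, inner_toLp_eq_integral hb hA, ← coeffA_eq hL, real_inner_comm (hΦ.toLp φ)]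
      linear_combination inner ℝ (hΦ.toLp _) (b j) * hlamw j
    have h2 := (b.hasSum_inner_mul_inner (hF.toLp _) W).unique h1
    have h3 : inner ℝ (hF.toLp _) U = ∫ t, (φ'' t + c t * φ t) * U t ∂intervalMeasure L := by
      rw [L2.inner_def]
      refine integral_congr_ae ?_
      filter_upwards [hF.coeFn_toLp] with t ht
      rw [ht]
      simp [mul_comm]
    rw [← h3, inner_add_right, inner_smul_right, h2, inner_toLp_toLp, inner_toLp_toLp,
      integral_mul_div_of_eq_zero hL hc hφ hφ' hφ'' hφL]
    ring
  have hU : U =ᵐ[intervalMeasure L] (0 : ℝ → ℝ) :=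
    ae_eq_zero_of_forall_integral_eq_zero hL hc (Lp.memLp U)
      fun φ φ' φ'' h1 h2 h3 h4 h5 => by rw [hkey φ φ' φ'' h1 h2 h3 h4, h5, mul_zero]
  have hx₀ : x₀ = 0 := by
    -- The function `φ(t) = t - L` detects the boundary value `u(L) = x₀`.
    have h1 := hkey (fun t => t - L) (fun _ => 1) (fun _ => 0)
      (fun t => (hasDerivAt_id t).sub_const L) (fun t => hasDerivAt_const t _) continuous_const
      (sub_self L)
    rw [mul_one] at h1
    rw [← h1]
    refine integral_eq_zero_of_ae ?_
    filter_upwards [hU] with t ht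
    rw [ht]
    simp
  have hW0 : W = 0 := by
    have : U = 0 := Lp.ext (hU.trans (Lp.coeFn_zero ℝ 2 (intervalMeasure L)).symm)
    simpa [U, hx₀] using this
  refine ⟨hx₀, fun j => ?_⟩
  rw [← hw_lt, ← hW, hW0, inner_zero_right]

theorem IsEigenbasis.det_fromBlocks_ne_zero (hL : 0 < L) (hc : MemLp c ⊤ (intervalMeasure L))
    (he : IsEigenbasis L c lam e) {n : ℕ} (hn : lam n < 0) :
    (Matrix.fromBlocks (matA1 L c lam e n) (matB1 L e n)
      (matL1 L c lam e n) (matBeta L lam e n)).det ≠ 0 := by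
  intro hdet
  obtain ⟨v, hv, hMv⟩ := Matrix.exists_mulVec_eq_zero_iff.2 hdet
  have hr : v (Sum.inr ()) = 0 := by
    have := congrFun hMv (Sum.inl (Sum.inl ()))
    simpa [Matrix.mulVec, dotProduct, matA1, matB1, Fintype.sum_sum_type] using this
  have hmode : ∀ j : Fin n, coeffA L c e j * v (Sum.inl (Sum.inl ()))
      + lam j * v (Sum.inl (Sum.inr j)) = 0 := by
    intro j
    have := congrFun hMv (Sum.inl (Sum.inr j))
    simpa [Matrix.mulVec, dotProduct, matA1, matB1, Fintype.sum_sum_type, hr,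
      Matrix.diagonal_apply] using this
  have htrace : alpha L c lam e n * v (Sum.inl (Sum.inl ()))
      + ∑ j : Fin n, leftTrace L e j * v (Sum.inl (Sum.inr j)) = 0 := by
    have := congrFun hMv (Sum.inr ())
    simpa [Matrix.mulVec, dotProduct, matL1, matBeta, Fintype.sum_sum_type, hr] using this
  obtain ⟨h0, h1⟩ := he.eq_zero_of_mem_kernel hL hc hn hmode htrace
  refine hv (funext ?_)
  rintro ((i | i) | i)
  · exact h0
  · exact h1 i
  · exact hr

end Kernel

theorem lemma1 (L : ℝ) (hL : 0 < L) (c : ℝ → ℝ) (hc : MemLp c ⊤ (intervalMeasure L))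
    (lam : ℕ → ℝ) (e : ℕ → ℝ → ℝ) (he : IsEigenbasis L c lam e)
    (n : ℕ) (hn_nonneg : ∀ j, j < n → 0 ≤ lam j) (hn_neg : lam n < 0) :
    Summable (alphaTerm L c lam e n) ∧ Summable (betaTerm L lam e n) ∧
      (Matrix.fromBlocks (matA1 L c lam e n) (matB1 L e n)
        (matL1 L c lam e n) (matBeta L lam e n)).det ≠ 0 ∧
      KalmanCondition (matA L c lam e n) (matB L lam e n) :=
  have hdet := he.det_fromBlocks_ne_zero hL hc hn_neg
  ⟨he.summable_alphaTerm hL hc hn_neg, he.summable_betaTerm hL hc hn_neg, hdet,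
    kalmanCondition_of_det_ne_zero he.strictAnti hdet (coeffA_add_mul_coeffB_ne_zero hL hc he)⟩
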